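/- Let $X$ be a real normed space of finite dimension $n\ge 3$ with closed unit ball $B_X$. For a linear subspace $Y\subseteq X$ put $$\lambda(Y,X)=\inf\{\|P\| : P:X\to Y \text{ is linear and bounded, and } P|_Y=\mathrm{id}_Y\}.$$ A facet of $B_X$ is an $(n-1)$-dimensional intersection of $B_X$ with a supporting hyperplane of $B_X$. Suppose that $B_X$ has exactly $N$ facets, where $N\ge 0$ is an integer. Then the number of $(n-1)$-dimensional linear subspaces $Y\subseteq X$ with $\lambda(Y,X)=2-\frac{2}{n}$ is finite and at most $\binom{N}{n}$. -/

import Mathlib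

/-- The relative projection constant `λ(Y, X)`: the infimum of the operator norms of the continuous
linear maps `P : X → Y` whose restriction to `Y` is the identity. -/
noncomputable def relProjConst {X : Type*} [NormedAddCommGroup X] [NormedSpace ℝ X]
    (Y : Submodule ℝ X) : ℝ :=
  sInf {c : ℝ | ∃ P : X →L[ℝ] Y, (∀ y : Y, P (y : X) = y) ∧ c = ‖P‖}

/-- `F` is a face of `C`: the intersection of `C` with a supporting hyperplane `{x | f x = c}`,
i.e. a hyperplane that meets `C` and has `C` on one side. -/
def IsFace {X : Type*} [NormedAddCommGroup X] [NormedSpace ℝ X] (C F : Set X) : Prop :=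
  F.Nonempty ∧ ∃ (f : X →L[ℝ] ℝ) (c : ℝ), f ≠ 0 ∧ (∀ x ∈ C, f x ≤ c) ∧ F = {x ∈ C | f x = c}

/-- `F` is a facet of `C`: a face of dimension `dim X - 1`, where the dimension of a nonempty set
is the dimension of its affine span. -/
def IsFacet {X : Type*} [NormedAddCommGroup X] [NormedSpace ℝ X] (C F : Set X) : Prop :=
  IsFace C F ∧ Module.finrank ℝ (vectorSpan ℝ F) + 1 = Module.finrank ℝ X

open Module Finset

universe u

/-! Write `Y = ker f`. Projections onto `Y` are `x ↦ x - f x • w` with `f w = 1`, so `λ(Y, X)` is a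
minimum over `w` of a supremum of linear functionals. By duality `λ • f` lies on the boundary of the
convex hull of `projFunctionals f`, and Carathéodory writes it with at most `n` terms `φ i (x i) • f
- f (x i) • φ i`. Evaluating at each `x j` and using `φ i (x j) ≥ -1` gives inequalities that `λ = 2
- 2 / n` makes tight (`eq_of_extremal_weights`): there are `n` terms, `φ i (x i) = 1`, `φ i (x j) =
-1` for `i ≠ j`, and `f` is proportional to `∑ φ i` (`exists_extremal_system`). Each face `φ i = 1`
of the ball contains `x i` and all `-x j`, a basis of `X`; hence it is a facet and determines `φ i`.
So `Y` is recovered from a set of `n` facets. -/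

/-! ### Convex hulls in finite dimension -/

/-- In a finite-dimensional space the convex hull of a compact set is compact. -/
theorem isCompact_convexHull_of_finiteDimensional {E : Type*} [NormedAddCommGroup E]
    [NormedSpace ℝ E] [FiniteDimensional ℝ E] {s : Set E} (hs : IsCompact s) :
    IsCompact (convexHull ℝ s) := by
  classical
  rcases s.eq_empty_or_nonempty with rfl | ⟨p, hp⟩
  · simp
  let κ := Fin (finrank ℝ E + 1)
  let K : Set ((κ → ℝ) × (κ → E)) := stdSimplex ℝ κ ×ˢ Set.univ.pi fun _ => s
  have hK : IsCompact K := (isCompact_stdSimplex ℝ κ).prod (isCompact_univ_pi fun _ => hs)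
  have hF : Continuous fun q : (κ → ℝ) × (κ → E) => ∑ i, q.1 i • q.2 i := by fun_prop
  convert hK.image hF
  ext x
  constructor
  · intro hx
    obtain ⟨ι, _, z, w, hz, hind, hw, hw1, rfl⟩ := eq_pos_convex_span_of_mem_convexHull hx
    have hcard : Fintype.card ι ≤ Fintype.card κ := by
      simpa [κ] using hind.card_le_finrank_succ.trans
        (Nat.succ_le_succ (Submodule.finrank_le (vectorSpan ℝ (Set.range z))))
    obtain ⟨e⟩ := Function.Embedding.nonempty_of_card_le hcard
    -- Pad to exactly `finrank ℝ E + 1` terms: weight `0` at the spare point `p`.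
    refine ⟨(Function.extend e w 0, Function.extend e z fun _ => p), ⟨⟨fun k => ?_, ?_⟩, ?_⟩, ?_⟩
    · by_cases hk : ∃ i, e i = k
      · obtain ⟨i, rfl⟩ := hk
        simpa [e.injective.extend_apply] using (hw i).le
      · simp [Function.extend_apply' _ _ _ hk]
    · rw [← hw1]
      refine (Fintype.sum_of_injective e e.injective _ _ (fun k hk => ?_) fun i => ?_).symm
      · simp [Function.extend_apply' _ _ _ hk]
      · simp [e.injective.extend_apply]
    · intro k _
      by_cases hk : ∃ i, e i = k
      · obtain ⟨i, rfl⟩ := hk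
        simpa [e.injective.extend_apply] using hz ⟨i, rfl⟩
      · simpa [Function.extend_apply' _ _ _ hk] using hp
    · refine (Fintype.sum_of_injective e e.injective _ _ (fun k hk => ?_) fun i => ?_).symm
      · simp [Function.extend_apply' _ _ _ hk]
      · simp [e.injective.extend_apply]
  · rintro ⟨⟨w, z⟩, ⟨⟨hw, hw1⟩, hz⟩, rfl⟩
    exact (convex_convexHull ℝ s).sum_mem (fun i _ => hw i) hw1
      fun i _ => subset_convexHull ℝ s (hz i trivial)

/-- Carathéodory's theorem for points outside the interior of the convex hull: one point fewer
is needed. -/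
theorem exists_convex_combination_card_le_finrank {E : Type u} [NormedAddCommGroup E]
    [NormedSpace ℝ E] [FiniteDimensional ℝ E] {s : Set E} {x : E} (hx : x ∈ convexHull ℝ s)
    (hx' : x ∉ interior (convexHull ℝ s)) :
    ∃ (ι : Type u) (_ : Fintype ι) (z : ι → E) (w : ι → ℝ), Fintype.card ι ≤ finrank ℝ E ∧
      (∀ i, z i ∈ s) ∧ (∀ i, 0 < w i) ∧ ∑ i, w i = 1 ∧ ∑ i, w i • z i = x := by
  obtain ⟨ι, _, z, w, hz, hind, hw, hw1, rfl⟩ := eq_pos_convex_span_of_mem_convexHull hx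
  refine ⟨ι, inferInstance, z, w, ?_, fun i => hz ⟨i, rfl⟩, hw, hw1, rfl⟩
  by_contra! hcard
  have hle : Fintype.card ι ≤ finrank ℝ E + 1 := hind.card_le_finrank_succ.trans
    (Nat.succ_le_succ (Submodule.finrank_le (vectorSpan ℝ (Set.range z))))
  have htop := (hind.affineSpan_eq_top_iff_card_eq_finrank_add_one).2 (by omega)
  -- With `finrank ℝ E + 1` independent points, positive weights are positive barycentric
  -- coordinates, which put the point in the interior.
  let b : AffineBasis ι ℝ E := ⟨z, hind, htop⟩
  refine hx' (interior_mono (convexHull_mono hz) ?_)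
  change _ ∈ interior (convexHull ℝ (Set.range b))
  rw [b.interior_convexHull]
  intro i
  have h := b.coord_apply_combination_of_mem (mem_univ i) hw1
  rw [affineCombination_eq_linear_combination _ _ _ hw1] at h
  exact (hw i).trans_eq h.symm

/-! ### The extremal weights -/

/-- The equality case of the numerical inequality behind Bohnenblust's bound `2 - 2 / n`. -/
theorem eq_of_extremal_weights {ι : Type*} [Fintype ι] {n : ℕ} (hn : 3 ≤ n)
    (hcard : Fintype.card ι ≤ n) {a s d : ι → ℝ} (ha : ∀ i, 0 < a i) (ha1 : ∑ i, a i = 1)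
    (hs : ∀ i, 0 ≤ s i) (has : ∑ i, a i * s i = 1) (hd : ∀ i, 0 ≤ d i)
    (h : ∀ j, (1 - 2 / (n : ℝ) + ∑ i, a i * d i) * s j + a j * s j * (2 - d j) ≤ 1) :
    Fintype.card ι = n ∧ ∀ i, a i = 1 / n ∧ s i = 1 ∧ d i = 0 := by
  have hn0 : (3 : ℝ) ≤ n := by exact_mod_cast hn
  set D : ℝ := 1 - 2 / (n : ℝ) with hD
  set Δ : ℝ := ∑ i, a i * d i with hΔ
  have hnD : n * D = n - 2 := by rw [hD]; field_simp
  have hD0 : 0 < D := by nlinarith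
  set A : ℝ := ∑ i, a i * (a i * s i) with hA
  set R : ℝ := ∑ i, s i with hR
  have hΔ0 : 0 ≤ Δ := sum_nonneg fun i _ => mul_nonneg (ha i).le (hd i)
  have hτ0 : ∀ i, 0 ≤ a i * s i := fun i => mul_nonneg (ha i).le (hs i)
  have hτ1 : ∀ i, a i * s i ≤ 1 := fun i =>
    has ▸ single_le_sum (f := fun i => a i * s i) (fun i _ => hτ0 i) (mem_univ i)
  have hsR : ∀ i, s i ≤ R := fun i => single_le_sum (fun i _ => hs i) (mem_univ i)
  -- the constraints averaged with the weights `a`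
  have e1 : ∑ j, a j * (1 - ((D + Δ) * s j + a j * s j * (2 - d j)))
      + ∑ j, a j * d j * (1 - a j * s j) = 1 - D - 2 * A := by
    have : ∀ j, a j * (1 - ((D + Δ) * s j + a j * s j * (2 - d j))) + a j * d j * (1 - a j * s j)
        = a j - (D + Δ) * (a j * s j) - 2 * (a j * (a j * s j)) + a j * d j := by intro j; ring
    rw [← sum_add_distrib, sum_congr rfl fun j _ => this j, sum_add_distrib, sum_sub_distrib,
      sum_sub_distrib, ← mul_sum, ← mul_sum, ha1, has]
    ring
  have p1 : ∀ j ∈ univ, 0 ≤ a j * (1 - ((D + Δ) * s j + a j * s j * (2 - d j))) := fun j _ =>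
    mul_nonneg (ha j).le (by linarith [h j])
  have p2 : ∀ j ∈ univ, 0 ≤ a j * d j * (1 - a j * s j) := fun j _ =>
    mul_nonneg (mul_nonneg (ha j).le (hd j)) (by linarith [hτ1 j])
  have hA1 : 2 * A ≤ 1 - D := by linarith [sum_nonneg p1, sum_nonneg p2]
  -- the plain sum of the constraints
  have e2 : D * R ≤ Fintype.card ι - 2 := by
    have h1 : ∑ j, ((D + Δ) * s j + a j * s j * (2 - d j)) ≤ ∑ _j : ι, (1 : ℝ) :=
      sum_le_sum fun j _ => h j
    have h2 : ∑ j, a j * s j * d j ≤ Δ * R := by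
      rw [hΔ, sum_mul]
      refine sum_le_sum fun j _ => ?_
      nlinarith [mul_nonneg (mul_nonneg (ha j).le (hd j)) (sub_nonneg.2 (hsR j))]
    have h3 : ∑ j, ((D + Δ) * s j + a j * s j * (2 - d j))
        = (D + Δ) * R + 2 - ∑ j, a j * s j * d j := by
      have : ∀ j, (D + Δ) * s j + a j * s j * (2 - d j)
        = (D + Δ) * s j + a j * s j * 2 - a j * s j * d j := by intro j; ring
      rw [sum_congr rfl fun j _ => this j, sum_sub_distrib, sum_add_distrib, ← mul_sum, ← sum_mul,
        has]
      ring
    rw [h3] at h1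
    simp only [sum_const, card_univ, nsmul_eq_mul, mul_one] at h1
    linarith
  have hcard' : (Fintype.card ι : ℝ) ≤ n := by exact_mod_cast hcard
  have hRn : R ≤ n := by
    by_contra! hlt
    nlinarith
  -- The two sums give `A ≤ 1 / n` and `R ≤ n`, so this weighted variance is at most `0` and every
  -- estimate so far is an equality.
  have e3 : ∑ i, s i * (a i - 1 / n) ^ 2 = A - 2 / n + R / n ^ 2 := by
    have : ∀ i, s i * (a i - 1 / n) ^ 2
        = a i * (a i * s i) - 2 / n * (a i * s i) + s i / n ^ 2 := by intro i; ring
    rw [sum_congr rfl fun j _ => this j, sum_add_distrib, sum_sub_distrib, ← mul_sum, has,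
      ← sum_div]
    ring
  have p3 : ∀ i ∈ univ, 0 ≤ s i * (a i - 1 / n) ^ 2 := fun i _ => mul_nonneg (hs i) (sq_nonneg _)
  have hRn2 : R / n ^ 2 ≤ 1 / n := by
    rw [div_le_div_iff₀ (by positivity) (by positivity)]
    nlinarith
  have hdiv : (2 : ℝ) / n = 1 / n + 1 / n := by ring
  have hA2 : A ≤ 1 / n := by linarith
  have hzero3 : ∑ i, s i * (a i - 1 / n) ^ 2 = 0 :=
    le_antisymm (by linarith) (sum_nonneg p3)
  have hAeq : A = 1 / n := by linarith
  have hReq : R = n := by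
    have : R / n ^ 2 = 1 / n := by linarith
    field_simp at this
    linarith
  have hcardeq : Fintype.card ι = n := by
    refine le_antisymm hcard ?_
    have : (n : ℝ) ≤ Fintype.card ι := by rw [hReq] at e2; linarith
    exact_mod_cast this
  refine ⟨hcardeq, ?_⟩
  have hz1 : ∀ j, (D + Δ) * s j + a j * s j * (2 - d j) = 1 := by
    have : ∑ j, a j * (1 - ((D + Δ) * s j + a j * s j * (2 - d j))) = 0 :=
      le_antisymm (by linarith [sum_nonneg p2]) (sum_nonneg p1)
    intro j
    have := (sum_eq_zero_iff_of_nonneg p1).1 this j (mem_univ j)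
    rcases mul_eq_zero.1 this with h0 | h0
    · exact absurd h0 (ha j).ne'
    · linarith
  have hz2 : ∀ j, d j = 0 ∨ a j * s j = 1 := by
    have : ∑ j, a j * d j * (1 - a j * s j) = 0 :=
      le_antisymm (by linarith [sum_nonneg p1]) (sum_nonneg p2)
    intro j
    have := (sum_eq_zero_iff_of_nonneg p2).1 this j (mem_univ j)
    rcases mul_eq_zero.1 this with h0 | h0
    · exact Or.inl ((mul_eq_zero.1 h0).resolve_left (ha j).ne')
    · exact Or.inr (by linarith)
  have hsne : ∀ j, s j ≠ 0 := fun j h0 => by simpa [h0] using hz1 j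
  have haeq : ∀ j, a j = 1 / n := fun j => by
    have := (sum_eq_zero_iff_of_nonneg p3).1 hzero3 j (mem_univ j)
    have := (mul_eq_zero.1 this).resolve_left (hsne j)
    linarith [pow_eq_zero_iff (two_ne_zero) |>.1 this]
  -- Otherwise `a j * s j = 1`, so `s j = n`, and the tight constraint reads `n + (Δ * n - d j) = 1`
  -- although `d j ≤ Δ * n`.
  have hd0 : ∀ j, d j = 0 := fun j => by
    refine (hz2 j).resolve_right fun h1 => ?_
    have hsj : s j = n := by
      rw [haeq j] at h1
      field_simp at h1
      exact h1
    have hdj : a j * d j ≤ Δ :=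
      single_le_sum (f := fun i => a i * d i) (fun i _ => mul_nonneg (ha i).le (hd i)) (mem_univ j)
    have hdj' : d j ≤ Δ * n := by
      rw [haeq j] at hdj
      field_simp at hdj
      linarith
    have := hz1 j
    rw [h1, hsj] at this
    nlinarith
  intro j
  refine ⟨haeq j, ?_, hd0 j⟩
  have hΔz : Δ = 0 := by simp [hΔ, hd0]
  have := hz1 j
  rw [hΔz, hd0 j, haeq j, hD] at this
  field_simp at this
  nlinarith

/-! ### Duality for projections onto a hyperplane -/

/-- The functionals `φ x • f - f x • φ` with `x` and `φ` in the unit balls. At `w` with `f w = 1`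
such a functional takes the value `φ (x - f x • w)`, so their supremum there is the norm of the
projection onto `ker f` along `w`. -/
def projFunctionals {X : Type*} [NormedAddCommGroup X] [NormedSpace ℝ X] (f : X →L[ℝ] ℝ) :
    Set (X →L[ℝ] ℝ) :=
  {g | ∃ (x : X) (φ : X →L[ℝ] ℝ), ‖x‖ ≤ 1 ∧ ‖φ‖ ≤ 1 ∧ g = φ x • f - f x • φ}

section

variable {X : Type*} [NormedAddCommGroup X] [NormedSpace ℝ X]

theorem apply_le_one {φ : X →L[ℝ] ℝ} {x : X} (hφ : ‖φ‖ ≤ 1) (hx : ‖x‖ ≤ 1) : φ x ≤ 1 :=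
  (le_abs_self _).trans <| (φ.le_opNorm x).trans (mul_le_one₀ hφ (norm_nonneg x) hx)

theorem neg_one_le_apply {φ : X →L[ℝ] ℝ} {x : X} (hφ : ‖φ‖ ≤ 1) (hx : ‖x‖ ≤ 1) : -1 ≤ φ x := by
  have := apply_le_one (φ := φ) (x := -x) hφ (by simpa)
  rw [map_neg] at this
  linarith

theorem isCompact_projFunctionals [FiniteDimensional ℝ X] (f : X →L[ℝ] ℝ) :
    IsCompact (projFunctionals f) := by
  have : ProperSpace X := FiniteDimensional.proper_real X
  have : ProperSpace (X →L[ℝ] ℝ) := FiniteDimensional.proper_real _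
  have hK := (isCompact_closedBall (0 : X) 1).prod (isCompact_closedBall (0 : X →L[ℝ] ℝ) 1)
  have hF : Continuous fun q : X × (X →L[ℝ] ℝ) => q.2 q.1 • f - f q.1 • q.2 := by fun_prop
  convert hK.image hF
  ext g
  constructor
  · rintro ⟨x, φ, hx, hφ, rfl⟩
    exact ⟨(x, φ), ⟨by simpa using hx, by simpa using hφ⟩, rfl⟩
  · rintro ⟨⟨x, φ⟩, ⟨hx, hφ⟩, rfl⟩
    exact ⟨x, φ, by simpa using hx, by simpa using hφ, rfl⟩

theorem relProjConst_bddBelow (Y : Submodule ℝ X) :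
    BddBelow {c : ℝ | ∃ P : X →L[ℝ] Y, (∀ y : Y, P (y : X) = y) ∧ c = ‖P‖} :=
  ⟨0, by rintro _ ⟨P, -, rfl⟩; exact norm_nonneg P⟩

/-- The projection onto `ker f` along a vector `w` with `f w = 1`. -/
noncomputable def projAlong (f : X →L[ℝ] ℝ) (w : X) (hw : f w = 1) :
    X →L[ℝ] LinearMap.ker (f : X →ₗ[ℝ] ℝ) :=
  (ContinuousLinearMap.id ℝ X - f.smulRight w).codRestrict _ fun x => by simp [hw]

theorem coe_projAlong (f : X →L[ℝ] ℝ) (w : X) (hw : f w = 1) (x : X) :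
    (projAlong f w hw x : X) = x - f x • w := rfl

theorem projAlong_apply_coe (f : X →L[ℝ] ℝ) (w : X) (hw : f w = 1)
    (y : LinearMap.ker (f : X →ₗ[ℝ] ℝ)) : projAlong f w hw (y : X) = y := by
  have hy : f y = 0 := y.2
  ext
  simp [coe_projAlong, hy]

theorem relProjConst_ker_le {f : X →L[ℝ] ℝ} {w : X} (hw : f w = 1) {u : ℝ}
    (hu : ∀ g ∈ projFunctionals f, g w ≤ u) :
    relProjConst (LinearMap.ker (f : X →ₗ[ℝ] ℝ)) ≤ u := by
  have hu0 : 0 ≤ u := by simpa using hu 0 ⟨0, 0, by simp, by simp, by simp⟩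
  refine (csInf_le (relProjConst_bddBelow _) ⟨projAlong f w hw, projAlong_apply_coe f w hw,
    rfl⟩).trans ?_
  refine ContinuousLinearMap.opNorm_le_of_unit_norm hu0 fun x hx => ?_
  obtain ⟨φ, hφ, hφx⟩ := exists_dual_vector'' ℝ (projAlong f w hw x : X)
  have := hu _ ⟨x, φ, hx.le, hφ, rfl⟩
  change ‖(projAlong f w hw x : X)‖ ≤ u
  simp only [coe_projAlong, map_sub, map_smul, smul_eq_mul, RCLike.ofReal_real_eq_id, id] at hφx ⊢
  simp only [sub_apply, smul_apply, smul_eq_mul, hw] at this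
  linarith

/-- A projection along `w` bounds every element of `projFunctionals f` at `w` by its norm; this
passes to the convex hull, and `q • f` takes the value `q` at `w`. -/
theorem le_relProjConst_ker {f : X →L[ℝ] ℝ} (hf : f ≠ 0) {q : ℝ}
    (hq : q • f ∈ convexHull ℝ (projFunctionals f)) :
    q ≤ relProjConst (LinearMap.ker (f : X →ₗ[ℝ] ℝ)) := by
  obtain ⟨v, hv⟩ : ∃ v, f v = 1 := by
    obtain ⟨v, hv⟩ := DFunLike.ne_iff.1 hf
    exact ⟨(f v)⁻¹ • v, by simpa using inv_mul_cancel₀ hv⟩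
  refine le_csInf ⟨_, projAlong f v hv, projAlong_apply_coe f v hv, rfl⟩ ?_
  rintro _ ⟨P, hP, rfl⟩
  set w : X := v - P v with hw_def
  have hPv : f (P v) = 0 := (P v).2
  have hw : f w = 1 := by rw [hw_def, map_sub, hPv, hv, sub_zero]
  have hPx : ∀ x, (P x : X) = x - f x • w := fun x => by
    have h1 := hP ⟨x - f x • v, by simp [hv]⟩
    have h2 := congrArg Subtype.val h1
    simp only [map_sub, map_smul, Submodule.coe_sub, Submodule.coe_smul] at h2
    rw [hw_def, smul_sub, sub_sub_eq_add_sub, add_sub_right_comm, ← h2]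
    abel
  have hsub : convexHull ℝ (projFunctionals f) ⊆ {g | g w ≤ ‖P‖} := by
    refine convexHull_min ?_ ?_
    · rintro _ ⟨x, φ, hx, hφ, rfl⟩
      have h1 : (φ x • f - f x • φ) w = φ (P x) := by
        rw [hPx]
        simp [hw]
      change (φ x • f - f x • φ) w ≤ ‖P‖
      rw [h1]
      calc φ (P x) ≤ ‖φ‖ * ‖(P x : X)‖ := (le_abs_self _).trans (φ.le_opNorm _)
        _ ≤ 1 * (‖P‖ * ‖x‖) := by
          gcongr
          exact P.le_opNorm x
        _ ≤ ‖P‖ := by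
          rw [one_mul]
          exact mul_le_of_le_one_right (norm_nonneg P) hx
    · intro g hg g' hg' a b ha hb hab
      simp only [Set.mem_ofPred_eq, add_apply, smul_apply,
        smul_eq_mul] at hg hg' ⊢
      calc a * g w + b * g' w ≤ a * ‖P‖ + b * ‖P‖ := by gcongr
        _ = ‖P‖ := by rw [← add_mul, hab, one_mul]
  simpa [hw] using hsub hq

theorem exists_forall_dual_apply_eq [FiniteDimensional ℝ X] (L : (X →L[ℝ] ℝ) →ₗ[ℝ] ℝ) :
    ∃ w : X, ∀ g : X →L[ℝ] ℝ, L g = g w := by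
  let e : (X →ₗ[ℝ] ℝ) ≃ₗ[ℝ] (X →L[ℝ] ℝ) := LinearMap.toContinuousLinearMap
  refine ⟨(evalEquiv ℝ X).symm (L ∘ₗ e.toLinearMap), fun g => ?_⟩
  calc L g = (L ∘ₗ e.toLinearMap) (e.symm g) := by simp
    _ = evalEquiv ℝ X ((evalEquiv ℝ X).symm (L ∘ₗ e.toLinearMap)) (e.symm g) := by
      rw [LinearEquiv.apply_symm_apply]
    _ = g _ := rfl

/-- Otherwise a separating functional is evaluation at some `w`; rescaled to `f w = 1`, it gives a
projection of norm below the infimum. -/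
theorem relProjConst_smul_mem_convexHull [FiniteDimensional ℝ X] (f : X →L[ℝ] ℝ) :
    relProjConst (LinearMap.ker (f : X →ₗ[ℝ] ℝ)) • f ∈ convexHull ℝ (projFunctionals f) := by
  by_contra hmem
  set l := relProjConst (LinearMap.ker (f : X →ₗ[ℝ] ℝ)) with hl
  have hl0 : 0 ≤ l := Real.sInf_nonneg (by rintro _ ⟨P, -, rfl⟩; exact norm_nonneg P)
  obtain ⟨L, u, hLu, hul⟩ := geometric_hahn_banach_closed_point (convex_convexHull ℝ _)
    (isCompact_convexHull_of_finiteDimensional (isCompact_projFunctionals f)).isClosed hmem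
  obtain ⟨w, hw⟩ := exists_forall_dual_apply_eq (L : (X →L[ℝ] ℝ) →ₗ[ℝ] ℝ)
  have hw' : ∀ g, L g = g w := hw
  have hu : ∀ g ∈ projFunctionals f, g w < u := fun g hg =>
    hw' g ▸ hLu g (subset_convexHull ℝ _ hg)
  have hu0 : 0 < u := by simpa using hu 0 ⟨0, 0, by simp, by simp, by simp⟩
  rw [hw'] at hul
  simp only [smul_apply, smul_eq_mul] at hul
  have hfw : 0 < f w := pos_of_mul_pos_right (hu0.trans hul) hl0
  have := relProjConst_ker_le (f := f) (w := (f w)⁻¹ • w) (u := (f w)⁻¹ * u)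
    (by simp [hfw.ne']) fun g hg => by
      rw [map_smul, smul_eq_mul]
      exact mul_le_mul_of_nonneg_left (hu g hg).le (by positivity)
  rw [← hl, inv_mul_eq_div, le_div_iff₀ hfw] at this
  linarith

theorem relProjConst_smul_notMem_interior {f : X →L[ℝ] ℝ} (hf : f ≠ 0) :
    relProjConst (LinearMap.ker (f : X →ₗ[ℝ] ℝ)) • f ∉
      interior (convexHull ℝ (projFunctionals f)) := by
  intro hmem
  set l := relProjConst (LinearMap.ker (f : X →ₗ[ℝ] ℝ)) with hl
  have hc : Continuous fun t : ℝ => t • f := by fun_prop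
  have hnhds : {t : ℝ | t • f ∈ interior (convexHull ℝ (projFunctionals f))} ∈ nhds l :=
    (isOpen_interior.preimage hc).mem_nhds hmem
  obtain ⟨ε, hε, hball⟩ := Metric.mem_nhds_iff.1 hnhds
  have h1 : l + ε / 2 ∈ Metric.ball l ε := by
    rw [Metric.mem_ball, Real.dist_eq, add_sub_cancel_left, abs_of_pos (by positivity)]
    linarith
  have := le_relProjConst_ker hf (interior_subset (hball h1))
  linarith

end

/-! ### The extremal system -/

theorem exists_apply_nonneg_of_mem_projFunctionals {X : Type*} [NormedAddCommGroup X]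
    [NormedSpace ℝ X] {f g : X →L[ℝ] ℝ} (hg : g ∈ projFunctionals f) :
    ∃ (x : X) (φ : X →L[ℝ] ℝ), ‖x‖ ≤ 1 ∧ ‖φ‖ ≤ 1 ∧ 0 ≤ f x ∧ g = φ x • f - f x • φ := by
  obtain ⟨x, φ, hx, hφ, rfl⟩ := hg
  rcases le_total 0 (f x) with h | h
  · exact ⟨x, φ, hx, hφ, h, rfl⟩
  · exact ⟨-x, -φ, by simpa, by simpa, by simpa, by simp⟩

/-- If `ker f` has the maximal relative projection constant, then `f` is proportional to the sum of
`n` norm-one functionals that take only the values `1` and `-1` on `n` suitable unit vectors. -/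
theorem exists_extremal_system {X : Type u} [NormedAddCommGroup X] [NormedSpace ℝ X]
    [FiniteDimensional ℝ X] {n : ℕ} (hn : 3 ≤ n) (hX : finrank ℝ X = n) {f : X →L[ℝ] ℝ}
    (hf : f ≠ 0) (hl : relProjConst (LinearMap.ker (f : X →ₗ[ℝ] ℝ)) = 2 - 2 / (n : ℝ)) :
    ∃ (ι : Type u) (_ : Fintype ι) (x : ι → X) (φ : ι → X →L[ℝ] ℝ), Fintype.card ι = n ∧
      (∀ i, ‖x i‖ ≤ 1) ∧ (∀ i, ‖φ i‖ ≤ 1) ∧ (∀ i, φ i (x i) = 1) ∧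
      (∀ i j, i ≠ j → φ i (x j) = -1) ∧ ∃ c : ℝ, c ≠ 0 ∧ ∑ i, φ i = c • f := by
  classical
  have hn0 : (3 : ℝ) ≤ n := by exact_mod_cast hn
  have hdim : finrank ℝ (X →L[ℝ] ℝ) = n := by
    rw [← hX, ← Subspace.dual_finrank_eq (K := ℝ) (V := X)]
    exact (LinearMap.toContinuousLinearMap (𝕜 := ℝ) (E := X) (F' := ℝ)).finrank_eq.symm
  obtain ⟨ι, _, z, a, hcard, hz, ha, ha1, hsum⟩ := exists_convex_combination_card_le_finrank
    (relProjConst_smul_mem_convexHull f) (relProjConst_smul_notMem_interior hf)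
  rw [hdim] at hcard
  choose x φ hx hφ hfx hzeq using fun i => exists_apply_nonneg_of_mem_projFunctionals (hz i)
  set d : ι → ℝ := fun i => 1 - φ i (x i) with hd
  have hd0 : ∀ i, 0 ≤ d i := fun i => sub_nonneg.2 (apply_le_one (hφ i) (hx i))
  set C : ℝ := 1 - 2 / (n : ℝ) + ∑ i, a i * d i with hC
  have hdiv : 2 / (n : ℝ) < 1 := by rw [div_lt_one (by linarith)]; linarith
  have hC0 : 0 < C := by
    have : 0 ≤ ∑ i, a i * d i := sum_nonneg fun i _ => mul_nonneg (ha i).le (hd0 i)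
    linarith
  have hcomb : ∑ i, (a i * f (x i)) • φ i = -(C • f) := by
    have h1 : ∑ i, a i • z i = (∑ i, a i * φ i (x i)) • f - ∑ i, (a i * f (x i)) • φ i := by
      rw [sum_smul, ← sum_sub_distrib]
      exact sum_congr rfl fun i _ => by rw [hzeq i, smul_sub, smul_smul, smul_smul]
    have h2 : ∑ i, a i * d i = 1 - ∑ i, a i * φ i (x i) := by
      simp only [hd, mul_sub, mul_one, sum_sub_distrib, ha1]
    have h3 : C = (2 - 2 / (n : ℝ)) - ∑ i, a i * φ i (x i) := by rw [hC, h2]; ring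
    rw [h1, hl] at hsum
    ext y
    have h4 := DFunLike.congr_fun hsum y
    simp only [sub_apply, neg_apply, smul_apply, smul_eq_mul] at h4 ⊢
    rw [h3]
    linarith
  set S : ℝ := ∑ i, a i * f (x i) with hS
  have hτ0 : ∀ i ∈ univ, 0 ≤ a i * f (x i) := fun i _ => mul_nonneg (ha i).le (hfx i)
  have hS0 : 0 < S := by
    refine (sum_nonneg hτ0).lt_of_ne fun h0 => hf ?_
    have h1 := (sum_eq_zero_iff_of_nonneg hτ0).1 h0.symm
    rw [sum_congr rfl fun i hi => by rw [h1 i hi, zero_smul], sum_const_zero, eq_comm,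
      neg_eq_zero] at hcomb
    exact (smul_eq_zero.1 hcomb).resolve_left hC0.ne'
  -- Adding `1` to `φ i (x j)` makes every term nonnegative, so the term `i = j` alone bounds the
  -- sum from below.
  have heval : ∀ j, ∑ i, a i * f (x i) * (1 + φ i (x j)) = S - C * f (x j) := fun j => by
    have h1 := DFunLike.congr_fun hcomb (x j)
    simp only [_root_.sum_apply, neg_apply, smul_apply, smul_eq_mul] at h1
    simp only [mul_add, mul_one, sum_add_distrib, h1, ← hS]
    ring
  have hterm : ∀ i j, 0 ≤ a i * f (x i) * (1 + φ i (x j)) := fun i j =>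
    mul_nonneg (hτ0 i (mem_univ i)) (by linarith [neg_one_le_apply (hφ i) (hx j)])
  have hconstr : ∀ j, C * (f (x j) / S) + a j * (f (x j) / S) * (2 - d j) ≤ 1 := fun j => by
    have h1 := single_le_sum (f := fun i => a i * f (x i) * (1 + φ i (x j)))
      (fun i _ => hterm i j) (mem_univ j)
    rw [heval j] at h1
    have h2 : C * (f (x j) / S) + a j * (f (x j) / S) * (2 - d j)
        = (C * f (x j) + a j * f (x j) * (1 + φ j (x j))) / S := by
      simp only [hd]
      ring
    rw [h2, div_le_one hS0]
    linarith
  obtain ⟨hcardn, hall⟩ := eq_of_extremal_weights hn hcard ha ha1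
    (fun i => div_nonneg (hfx i) hS0.le)
    (by simp only [← mul_div_assoc, ← sum_div, ← hS, div_self hS0.ne']) hd0 hconstr
  have hfS : ∀ i, f (x i) = S := fun i => by
    have := (hall i).2.1
    rwa [div_eq_one_iff_eq hS0.ne'] at this
  have hdz : ∀ i, d i = 0 := fun i => (hall i).2.2
  have hdiag : ∀ i, φ i (x i) = 1 := fun i => by linarith [hdz i, show d i = 1 - φ i (x i) from rfl]
  have hCeq : C = 1 - 2 / (n : ℝ) := by simp [hC, hdz]
  refine ⟨ι, inferInstance, x, φ, hcardn, hx, hφ, hdiag, fun i j hij => ?_, -(n * C / S), ?_, ?_⟩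
  · have h1 := heval j
    rw [← add_sum_erase _ _ (mem_univ j), hdiag, (hall j).1, hfS, hCeq] at h1
    -- In the equality case the term `i = j` exhausts the sum, so the others vanish.
    have h2 : ∑ i ∈ univ.erase j, a i * f (x i) * (1 + φ i (x j)) = 0 := by
      have : S - (1 - 2 / (n : ℝ)) * S = 1 / n * S * (1 + 1) := by ring
      linarith
    have h3 := (sum_eq_zero_iff_of_nonneg fun i _ => hterm i j).1 h2 i
      (mem_erase.2 ⟨hij, mem_univ i⟩)
    rw [hfS] at h3
    have := (mul_eq_zero.1 h3).resolve_left (mul_pos (ha i) hS0).ne'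
    linarith
  · have : 0 < n * C / S := by positivity
    exact neg_ne_zero.2 this.ne'
  · have h1 : ∑ i, (a i * f (x i)) • φ i = (S / n) • ∑ i, φ i := by
      rw [smul_sum]
      exact sum_congr rfl fun i _ => by rw [hfS, (hall i).1, one_div_mul_eq_div]
    rw [h1] at hcomb
    ext y
    have h2 := DFunLike.congr_fun hcomb y
    simp only [neg_apply, smul_apply, smul_eq_mul] at h2 ⊢
    field_simp at h2 ⊢
    linarith

/-! ### Facets from the extremal system -/

section

variable {X : Type*} [NormedAddCommGroup X] [NormedSpace ℝ X] {ι : Type*} [Fintype ι]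
  {x : ι → X} {φ : ι → X →L[ℝ] ℝ}

/-- Applying `φ i` to a relation gives `2 * c i = ∑ c j`; summing over `i` forces `∑ c j = 0`, as
there are more than two indices. -/
theorem linearIndependent_of_apply_eq (hcard : 3 ≤ Fintype.card ι) (hdiag : ∀ i, φ i (x i) = 1)
    (hoff : ∀ i j, i ≠ j → φ i (x j) = -1) : LinearIndependent ℝ x := by
  classical
  rw [Fintype.linearIndependent_iff]
  intro c hc
  have h1 : ∀ i, 2 * c i = ∑ j, c j := fun i => by
    have h2 := congrArg (φ i) hc
    simp only [map_sum, map_smul, smul_eq_mul, map_zero] at h2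
    rw [← add_sum_erase _ _ (mem_univ i), hdiag, sum_congr rfl fun j hj => by
      rw [hoff i j (ne_of_mem_erase hj).symm]] at h2
    rw [← add_sum_erase _ _ (mem_univ i)]
    rw [← sum_mul] at h2
    linarith
  have h2 : (Fintype.card ι : ℝ) * (∑ j, c j) = 2 * ∑ j, c j := by
    rw [mul_sum univ c 2, sum_congr rfl fun i _ => h1 i]
    simp
  have h3 : ∑ j, c j = 0 := by
    have : (3 : ℝ) ≤ Fintype.card ι := by exact_mod_cast hcard
    have h4 : ((Fintype.card ι : ℝ) - 2) * ∑ j, c j = 0 := by linarith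
    exact (mul_eq_zero.1 h4).resolve_left (by linarith)
  intro i
  linarith [h1 i]

theorem span_eq_top_of_apply_eq [FiniteDimensional ℝ X] (hcard : 3 ≤ Fintype.card ι)
    (hX : finrank ℝ X = Fintype.card ι) (hdiag : ∀ i, φ i (x i) = 1)
    (hoff : ∀ i j, i ≠ j → φ i (x j) = -1) : Submodule.span ℝ (Set.range x) = ⊤ :=
  (linearIndependent_of_apply_eq hcard hdiag hoff).span_eq_top_of_card_eq_finrank' hX.symm

theorem eq_of_apply_eq_one_on_face [FiniteDimensional ℝ X] (hcard : 3 ≤ Fintype.card ι)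
    (hX : finrank ℝ X = Fintype.card ι) (hx : ∀ i, ‖x i‖ ≤ 1) (hdiag : ∀ i, φ i (x i) = 1)
    (hoff : ∀ i j, i ≠ j → φ i (x j) = -1) (i : ι) {ψ : X →L[ℝ] ℝ}
    (hψ : ∀ y ∈ {y ∈ Metric.closedBall (0 : X) 1 | φ i y = 1}, ψ y = 1) : ψ = φ i := by
  have h : (ψ : X →ₗ[ℝ] ℝ) = φ i := by
    refine LinearMap.ext_on_range (span_eq_top_of_apply_eq hcard hX hdiag hoff) fun j => ?_
    change ψ (x j) = φ i (x j)
    rcases eq_or_ne i j with rfl | hij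
    · rw [hdiag, hψ _ ⟨by simpa using hx i, hdiag i⟩]
    · have := hψ (-x j) ⟨by simpa using hx j, by rw [map_neg, hoff i j hij, neg_neg]⟩
      rw [map_neg] at this
      rw [hoff i j hij]
      linarith
  exact ContinuousLinearMap.coe_injective h

theorem isFacet_of_apply_eq [FiniteDimensional ℝ X] (hcard : 3 ≤ Fintype.card ι)
    (hX : finrank ℝ X = Fintype.card ι) (hx : ∀ i, ‖x i‖ ≤ 1) (hφ : ∀ i, ‖φ i‖ ≤ 1)
    (hdiag : ∀ i, φ i (x i) = 1) (hoff : ∀ i j, i ≠ j → φ i (x j) = -1) (i : ι) :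
    IsFacet (Metric.closedBall (0 : X) 1) {y ∈ Metric.closedBall (0 : X) 1 | φ i y = 1} := by
  set F : Set X := {y ∈ Metric.closedBall (0 : X) 1 | φ i y = 1} with hF
  have hxi : x i ∈ F := ⟨by simpa using hx i, hdiag i⟩
  have hφi : φ i ≠ 0 := fun h => by simpa [h] using hdiag i
  refine ⟨⟨⟨x i, hxi⟩, φ i, 1, hφi, fun y hy => apply_le_one (hφ i) (by simpa using hy), hF⟩, ?_⟩
  refine le_antisymm ?_ ?_
  · refine Submodule.finrank_lt (lt_of_le_of_lt
      (b := LinearMap.ker (φ i : X →ₗ[ℝ] ℝ)) ?_ (lt_top_iff_ne_top.2 fun h => hφi ?_)).ne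
    · rw [vectorSpan_def, Submodule.span_le]
      rintro _ ⟨y, hy, y', hy', rfl⟩
      simp [hy.2, hy'.2]
    · exact ContinuousLinearMap.coe_injective (LinearMap.ker_eq_top.1 h)
  · have htop : vectorSpan ℝ F ⊔ Submodule.span ℝ {x i} = ⊤ := by
      rw [eq_top_iff, ← span_eq_top_of_apply_eq hcard hX hdiag hoff, Submodule.span_le]
      rintro _ ⟨j, rfl⟩
      have hxi' : x i ∈ Submodule.span ℝ {x i} := Submodule.mem_span_singleton_self _
      rcases eq_or_ne i j with rfl | hij
      · exact Submodule.mem_sup_right hxi'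
      · have hj : -x j ∈ F := ⟨by simpa using hx j, by rw [map_neg, hoff i j hij, neg_neg]⟩
        have h1 := vsub_mem_vectorSpan ℝ hxi hj
        rw [vsub_eq_sub, sub_neg_eq_add] at h1
        have := Submodule.sub_mem _ (Submodule.mem_sup_left (T := Submodule.span ℝ {x i}) h1)
          (Submodule.mem_sup_right (S := vectorSpan ℝ F) hxi')
        simpa using this
    calc finrank ℝ X = finrank ℝ ↥(vectorSpan ℝ F ⊔ Submodule.span ℝ {x i}) := by
          rw [htop, finrank_top]
      _ ≤ finrank ℝ (vectorSpan ℝ F) + finrank ℝ (Submodule.span ℝ {x i}) :=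
          Submodule.finrank_add_le_finrank_add_finrank _ _
      _ ≤ finrank ℝ (vectorSpan ℝ F) + 1 := by
          gcongr
          simpa using finrank_span_le_card (R := ℝ) ({x i} : Set X)

end

/-! ### Counting the hyperplanes -/

/-- A functional that equals `1` on `F`, if there is one. -/
noncomputable def faceFunctional {X : Type*} [NormedAddCommGroup X] [NormedSpace ℝ X]
    (F : Set X) : X →L[ℝ] ℝ :=
  Classical.epsilon fun ψ => ∀ y ∈ F, ψ y = 1

theorem exists_continuousLinearMap_ker_eq {X : Type*} [NormedAddCommGroup X] [NormedSpace ℝ X]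
    [FiniteDimensional ℝ X] {Y : Submodule ℝ X} (hY : finrank ℝ Y + 1 = finrank ℝ X) :
    ∃ f : X →L[ℝ] ℝ, f ≠ 0 ∧ Y = LinearMap.ker (f : X →ₗ[ℝ] ℝ) := by
  have hlt : Y < ⊤ := lt_top_iff_ne_top.2 fun h => by
    rw [h, finrank_top] at hY
    omega
  obtain ⟨g, hg, hle⟩ := Y.exists_le_ker_of_lt_top hlt
  refine ⟨LinearMap.toContinuousLinearMap g, by simpa using hg, ?_⟩
  refine Submodule.eq_of_le_of_finrank_le hle ?_
  have : finrank ℝ (LinearMap.ker g) < finrank ℝ X :=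
    Submodule.finrank_lt fun h => hg (LinearMap.ker_eq_top.1 h)
  change finrank ℝ (LinearMap.ker g) ≤ finrank ℝ Y
  omega

theorem exists_facets_of_relProjConst_eq {X : Type*} [NormedAddCommGroup X] [NormedSpace ℝ X]
    [FiniteDimensional ℝ X] {n : ℕ} (hn : 3 ≤ n) (hX : finrank ℝ X = n) {Y : Submodule ℝ X}
    (hY : finrank ℝ Y + 1 = n) (hl : relProjConst Y = 2 - 2 / (n : ℝ)) :
    ∃ t : Finset (Set X), t.card = n ∧ (∀ F ∈ t, IsFacet (Metric.closedBall (0 : X) 1) F) ∧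
      LinearMap.ker ((∑ F ∈ t, faceFunctional F : X →L[ℝ] ℝ) : X →ₗ[ℝ] ℝ) = Y := by
  classical
  obtain ⟨f, hf, rfl⟩ := exists_continuousLinearMap_ker_eq (hY.trans hX.symm)
  obtain ⟨ι, _, x, φ, hcard, hx, hφ, hdiag, hoff, c, hc, hsum⟩ := exists_extremal_system hn hX hf hl
  have h3 : 3 ≤ Fintype.card ι := hcard ▸ hn
  have hXι := hX.trans hcard.symm
  set G : ι → Set X := fun i => {y ∈ Metric.closedBall (0 : X) 1 | φ i y = 1} with hG
  have hfun : ∀ i, faceFunctional (G i) = φ i := fun i =>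
    eq_of_apply_eq_one_on_face h3 hXι hx hdiag hoff i
      (Classical.epsilon_spec (p := fun ψ : X →L[ℝ] ℝ => ∀ y ∈ G i, ψ y = 1)
        ⟨φ i, fun y hy => hy.2⟩)
  have hinj : Function.Injective G := fun i j hij => by
    by_contra hne
    have h1 : φ i = φ j := by rw [← hfun i, ← hfun j, hij]
    have h2 := hoff i j hne
    rw [h1, hdiag] at h2
    norm_num at h2
  refine ⟨univ.image G, ?_, ?_, ?_⟩
  · rw [card_image_of_injective _ hinj, card_univ, hcard]
  · intro F hF
    obtain ⟨i, -, rfl⟩ := mem_image.1 hF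
    exact isFacet_of_apply_eq h3 hXι hx hφ hdiag hoff i
  · rw [sum_image hinj.injOn, sum_congr rfl fun i _ => hfun i, hsum]
    ext y
    simp [hc]

theorem theorem2p8 {X : Type*} [NormedAddCommGroup X] [NormedSpace ℝ X] [FiniteDimensional ℝ X]
    (n : ℕ) (hn : 3 ≤ n) (hX : Module.finrank ℝ X = n)
    (N : ℕ) (hN : {F : Set X | IsFacet (Metric.closedBall (0 : X) 1) F}.encard = (N : ℕ∞)) :
    {Y : Submodule ℝ X | Module.finrank ℝ Y + 1 = n ∧
      relProjConst Y = 2 - 2 / (n : ℝ)}.encard ≤ (N.choose n : ℕ∞) := by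
  classical
  obtain ⟨A, hA⟩ := (Set.finite_of_encard_eq_coe hN).exists_finset_coe
  have hAcard : A.card = N := by
    rw [← hA, Set.encard_coe_eq_coe_finsetCard] at hN
    exact_mod_cast hN
  have hsub : {Y : Submodule ℝ X | Module.finrank ℝ Y + 1 = n ∧
      relProjConst Y = 2 - 2 / (n : ℝ)} ⊆
      (fun t : Finset (Set X) =>
        LinearMap.ker ((∑ F ∈ t, faceFunctional F : X →L[ℝ] ℝ) : X →ₗ[ℝ] ℝ)) ''
        (A.powersetCard n : Set (Finset (Set X))) := by
    rintro Y ⟨hY, hl⟩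
    obtain ⟨t, ht, htF, hker⟩ := exists_facets_of_relProjConst_eq hn hX hY hl
    refine ⟨t, mem_coe.2 (mem_powersetCard.2 ⟨fun F hF => ?_, ht⟩), hker⟩
    rw [← mem_coe, hA]
    exact htF F hF
  calc _ ≤ _ := Set.encard_le_encard hsub
    _ ≤ (A.powersetCard n : Set (Finset (Set X))).encard := Set.encard_image_le _ _
    _ = (N.choose n : ℕ∞) := by
      rw [Set.encard_coe_eq_coe_finsetCard, card_powersetCard, hAcard]
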